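/- **Proposition 3.2.** Let $\psi:\{1,2,\dots\}\to\mathbb R$ satisfy $\psi(k)>-1$ for all $k\ge 1$ and $\psi(k)\to 0$ as $k\to\infty$. Put $w(k)=(1+\psi(k))k^{-5/2}$, $\overline w=\sum_{\ell\ge 1}w(\ell)$ and $p(k)=w(k)/\overline w$ for $k\ge 1$. Let $\xi_1,\xi_2,\dots$ be independent random variables with $\mathbb P(\xi_i=k)=p(k)$ for all $i,k\ge 1$; write $S_k=\xi_1+\dots+\xi_k$ and $\nu=\mathbb E[\xi_1]$. Let $r(n)$ be positive integers with $r(n)=o(n)$ and $r(n)>(\ln n)^{25}$ for all sufficiently large $n$, put $m(n)=n-r(n)$, and let $N(n)$ be integers with $1\le N(n)\le m(n)$ for all sufficiently large $n$. Let $\xi_{(1)}\ge\xi_{(2)}\ge\dots\ge\xi_{(N(n))}$ be the decreasing rearrangement of $\xi_1,\dots,\xi_{N(n)}$ (with $\xi_{(2)}=0$ if $N(n)=1$). If $\limsup_{n\to\infty}\frac{\nu N(n)}{m(n)}<1$, then $\mathbb P(S_{N(n)}=m(n))>0$ for all sufficiently large $n$, and, as $n\to\infty$, $$\mathbb P\left(\xi_{(1)}>\frac{m(n)}{(\ln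 n)^2},\ \xi_{(2)}>r(n)^{5/6}\ \Big|\ S_{N(n)}=m(n)\right)=O\left(N(n)(\ln n)^5\,r(n)^{-5/4}\right).$$ -/

import Mathlib

open MeasureTheory ProbabilityTheory Filter Topology Asymptotics

noncomputable section

namespace RandomAllocation

/-- The weight `w(k) = (1 + ψ(k)) / k^{5/2}` of an integer `k ≥ 1`. -/
def weight (ψ : ℕ → ℝ) (k : ℕ) : ℝ := (1 + ψ k) / (k : ℝ) ^ ((5 : ℝ) / 2)

/-- The total weight `∑_{ℓ ≥ 1} w(ℓ)`. -/
def totalWeight (ψ : ℕ → ℝ) : ℝ := ∑' l : ℕ, weight ψ (l + 1)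

/-- The probability `p(k) = w(k) / ∑_{ℓ ≥ 1} w(ℓ)` of an integer `k ≥ 1`. -/
def prob (ψ : ℕ → ℝ) (k : ℕ) : ℝ := weight ψ k / totalWeight ψ

/-- `kthLargest x N j` is the entry `x_{(j)}` of the decreasing rearrangement
`x_{(1)} ≥ x_{(2)} ≥ … ≥ x_{(N)}` of the `N` numbers `x 0, …, x (N - 1)`, for `1 ≤ j ≤ N`
(multiplicities are counted). It is `0` when `j > N`. -/
def kthLargest (x : ℕ → ℕ) (N j : ℕ) : ℕ :=
  (((Multiset.range N).map x).sort (· ≥ ·)).getD (j - 1) 0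

end RandomAllocation

end

/-! The event `S_N = m` is typically produced by one big jump. Since the mean of `S_N` is at most
`q m` with `q < 1`, with probability bounded below all variables but a given one are at most `δ m`
and sum to less than `(1 - δ) m`; the remaining variable then makes up the deficit with
conditional probability at least `c m ^ (-5/2)`. These events are disjoint for different choices
of the big variable, so `P (S_N = m) ≳ N m ^ (-5/2)`.

If in addition `ξ₍₁₎ > m / L` and `ξ₍₂₎ > b`, then some `ξ j` exceeds `b`, at cost `b ^ (-3/2)`,
and some other `ξ i` must take the one value above `m / L` that completes the sum, at cost
`(m / L) ^ (-5/2)`. A union bound over the `N ^ 2` pairs and division by the lower bound give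
`N L ^ (5/2) b ^ (-3/2)`, which for `L = (ln n) ^ 2` and `b = r ^ (5/6)` is the claimed rate. -/

namespace RandomAllocation

theorem rpow_neg_le_mul_rpow_sub {β x : ℝ} (hβ : 1 < β) (hx : 1 ≤ x) :
    x ^ (-β) ≤ 2 ^ β / (β - 1) * (x ^ (1 - β) - (x + 1) ^ (1 - β)) := by
  have hx0 : 0 < x := by linarith
  have hβ0 : 0 < β - 1 := by linarith
  have bernoulli : (1 + β * x⁻¹) * (x + 1) ^ (-β) ≤ x ^ (-β) := by
    have h := one_add_mul_self_le_rpow_one_add (s := x⁻¹) (by linarith [inv_pos.2 hx0]) hβ.le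
    have hsplit : 1 + x⁻¹ = (x + 1) / x := by field_simp
    rw [hsplit, Real.div_rpow (by positivity) hx0.le] at h
    rw [Real.rpow_neg (by positivity), Real.rpow_neg hx0.le]
    calc _ ≤ (x + 1) ^ β / x ^ β * ((x + 1) ^ β)⁻¹ := by gcongr
      _ = (x ^ β)⁻¹ := by field_simp
  have gap : (β - 1) * (x + 1) ^ (-β) ≤ x ^ (1 - β) - (x + 1) ^ (1 - β) := by
    rw [sub_eq_neg_add 1 β, Real.rpow_add_one hx0.ne', Real.rpow_add_one (by positivity)]
    have h := mul_le_mul_of_nonneg_right bernoulli hx0.le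
    have hexp : (1 + β * x⁻¹) * (x + 1) ^ (-β) * x = (x + β) * (x + 1) ^ (-β) := by field_simp
    linarith
  have double : 2 ^ (-β) * x ^ (-β) ≤ (x + 1) ^ (-β) := by
    rw [← Real.mul_rpow (by norm_num) hx0.le]
    exact Real.rpow_le_rpow_of_nonpos (by positivity) (by linarith) (by linarith)
  calc x ^ (-β) = 2 ^ β / (β - 1) * ((β - 1) * (2 ^ (-β) * x ^ (-β))) := by
        rw [Real.rpow_neg zero_le_two]; field_simp
    _ ≤ 2 ^ β / (β - 1) * (x ^ (1 - β) - (x + 1) ^ (1 - β)) := by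
        gcongr
        exact (mul_le_mul_of_nonneg_left double hβ0.le).trans gap

section Independence

variable {Ω S T : Type*} [MeasurableSpace Ω] {P : Measure Ω} [IsFiniteMeasure P]
  [MeasurableSpace S] [Countable S] [DiscreteMeasurableSpace S]
  [MeasurableSpace T] [Countable T] [DiscreteMeasurableSpace T] {X : Ω → S} {Y : Ω → T}

theorem measure_mem_eq_lintegral_of_indepFun (hY : Measurable Y) (hX : Measurable X)
    (h : IndepFun Y X P) (g : T → Set S) :
    P {ω | X ω ∈ g (Y ω)} = ∫⁻ ω, P {ω' | X ω' ∈ g (Y ω)} ∂P := by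
  have hg : MeasurableSet {z : T × S | z.2 ∈ g z.1} := .of_discrete
  calc P {ω | X ω ∈ g (Y ω)} = P.map (fun ω => (Y ω, X ω)) {z | z.2 ∈ g z.1} := by
        rw [Measure.map_apply (hY.prodMk hX) hg]; rfl
    _ = ∫⁻ ω, P.map X {k | k ∈ g (Y ω)} ∂P := by
        rw [(indepFun_iff_map_prod_eq_prod_map_map hY.aemeasurable hX.aemeasurable).1 h,
          Measure.prod_apply hg, lintegral_map (measurable_of_countable _) hY]
        rfl
    _ = ∫⁻ ω, P {ω' | X ω' ∈ g (Y ω)} ∂P :=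
        lintegral_congr fun ω => Measure.map_apply hX .of_discrete

theorem measure_mem_and_mem_eq_setLIntegral (hY : Measurable Y) (hX : Measurable X)
    (h : IndepFun Y X P) (B : Set T) (g : T → Set S) :
    P {ω | Y ω ∈ B ∧ X ω ∈ g (Y ω)} = ∫⁻ ω in Y ⁻¹' B, P {ω' | X ω' ∈ g (Y ω)} ∂P := by
  have hjoint := measure_mem_eq_lintegral_of_indepFun hY hX h fun t => {k | t ∈ B ∧ k ∈ g t}
  simp only [Set.mem_ofPred_eq] at hjoint
  rw [hjoint, ← lintegral_indicator (hY .of_discrete)]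
  refine lintegral_congr fun ω => ?_
  by_cases hω : Y ω ∈ B <;> simp [hω]

theorem measureReal_mem_and_mem_le (hY : Measurable Y) (hX : Measurable X) (h : IndepFun Y X P)
    {B : Set T} {g : T → Set S} {M : ℝ} (hM0 : 0 ≤ M)
    (hM : ∀ t ∈ B, P.real {ω | X ω ∈ g t} ≤ M) :
    P.real {ω | Y ω ∈ B ∧ X ω ∈ g (Y ω)} ≤ M * P.real (Y ⁻¹' B) := by
  refine ENNReal.toReal_le_of_le_ofReal (by positivity) ?_
  rw [measure_mem_and_mem_eq_setLIntegral hY hX h, ENNReal.ofReal_mul hM0, ofReal_measureReal,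
    ← setLIntegral_const]
  refine setLIntegral_mono' (hY .of_discrete) fun ω hω => ?_
  rw [← ofReal_measureReal]
  exact ENNReal.ofReal_le_ofReal (hM _ hω)

theorem le_measureReal_mem_and_mem (hY : Measurable Y) (hX : Measurable X) (h : IndepFun Y X P)
    {B : Set T} {g : T → Set S} {M : ℝ} (hM0 : 0 ≤ M)
    (hM : ∀ t ∈ B, M ≤ P.real {ω | X ω ∈ g t}) :
    M * P.real (Y ⁻¹' B) ≤ P.real {ω | Y ω ∈ B ∧ X ω ∈ g (Y ω)} := by
  refine (ENNReal.ofReal_le_iff_le_toReal (by finiteness)).1 ?_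
  rw [measure_mem_and_mem_eq_setLIntegral hY hX h, ENNReal.ofReal_mul hM0, ofReal_measureReal,
    ← setLIntegral_const]
  refine setLIntegral_mono' (hY .of_discrete) fun ω hω => ?_
  rw [← ofReal_measureReal]
  exact ENNReal.ofReal_le_ofReal (hM _ hω)

end Independence

section PowerLaw

/-- The constant `D` such that atoms of mass at most `C k ^ (-β)` give tails
`P (b < X) ≤ D b ^ (1 - β)`. -/
noncomputable def tailConst (β C : ℝ) : ℝ := C * (2 ^ β / (β - 1))

theorem tailConst_nonneg {β C : ℝ} (hβ : 1 < β) (hC : 0 ≤ C) : 0 ≤ tailConst β C :=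
  mul_nonneg hC (div_nonneg (by positivity) (by linarith))

variable {Ω : Type*} [MeasurableSpace Ω] {P : Measure Ω} {X : Ω → ℕ} {β c C : ℝ}

theorem lintegral_natCast_eq_tsum (hX : Measurable X) :
    ∫⁻ ω, (X ω : ENNReal) ∂P = ∑' k : ℕ, (k : ENNReal) * P {ω | X ω = k} := by
  rw [← lintegral_map (f := fun k : ℕ => (k : ENNReal)) (measurable_of_countable _) hX,
    lintegral_countable']
  exact tsum_congr fun k => by rw [Measure.map_apply hX .of_discrete]; rfl

theorem integral_natCast_congr {Y : Ω → ℕ} (hX : Measurable X) (hY : Measurable Y)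
    (h : ∀ k : ℕ, 1 ≤ k → P {ω | X ω = k} = P {ω | Y ω = k}) :
    ∫ ω, (X ω : ℝ) ∂P = ∫ ω, (Y ω : ℝ) ∂P := by
  have hlint : ∫⁻ ω, (X ω : ENNReal) ∂P = ∫⁻ ω, (Y ω : ENNReal) ∂P := by
    rw [lintegral_natCast_eq_tsum hX, lintegral_natCast_eq_tsum hY]
    refine tsum_congr fun k => ?_
    rcases k.eq_zero_or_pos with rfl | hk
    · simp
    · rw [h k hk]
  have htoReal : ∀ {Z : Ω → ℕ}, Measurable Z →
      ∫ ω, (Z ω : ℝ) ∂P = (∫⁻ ω, (Z ω : ENNReal) ∂P).toReal := fun {Z} hZ => by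
    have hZ' : AEMeasurable (fun ω => (Z ω : ENNReal)) P := by fun_prop
    simp only [← integral_toReal hZ' (ae_of_all _ fun _ => ENNReal.natCast_lt_top _),
      ENNReal.toReal_natCast]
  rw [htoReal hX, htoReal hY, hlint]

theorem nonneg_of_measureReal_eq_le
    (hub : ∀ k : ℕ, 1 ≤ k → P.real {ω | X ω = k} ≤ C * (k : ℝ) ^ (-β)) : 0 ≤ C := by
  simpa using measureReal_nonneg.trans (hub 1 le_rfl)

variable [IsFiniteMeasure P]

theorem integrable_natCast_of_measureReal_eq_le (hX : Measurable X) (hβ : 2 < β)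
    (hub : ∀ k : ℕ, 1 ≤ k → P.real {ω | X ω = k} ≤ C * (k : ℝ) ^ (-β)) :
    Integrable (fun ω => (X ω : ℝ)) P := by
  have hsum : Summable fun k : ℕ => C * (k : ℝ) ^ (1 - β) :=
    (Real.summable_nat_rpow.2 (by linarith)).mul_left C
  have hX' : AEMeasurable (fun ω => (X ω : ENNReal)) P := by fun_prop
  have hfin : ∫⁻ ω, (X ω : ENNReal) ∂P ≠ ⊤ := by
    rw [lintegral_natCast_eq_tsum hX]
    refine ne_top_of_le_ne_top hsum.tsum_ofReal_ne_top (ENNReal.tsum_le_tsum fun k => ?_)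
    rcases k.eq_zero_or_pos with rfl | hk
    · simp
    have hk' : (k : ℝ) ≠ 0 := by positivity
    rw [← ofReal_measureReal, ← ENNReal.ofReal_natCast, ← ENNReal.ofReal_mul (by positivity)]
    refine ENNReal.ofReal_le_ofReal ?_
    calc (k : ℝ) * P.real {ω | X ω = k} ≤ k * (C * (k : ℝ) ^ (-β)) := by gcongr; exact hub k hk
      _ = C * (k : ℝ) ^ (1 - β) := by rw [sub_eq_neg_add, Real.rpow_add_one hk']; ring
  simpa using integrable_toReal_of_lintegral_ne_top hX' hfin

theorem le_integral_natCast_of_le_measureReal_eq_one (hX : Integrable (fun ω => (X ω : ℝ)) P)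
    (hlb : c ≤ P.real {ω | X ω = 1}) : c ≤ ∫ ω, (X ω : ℝ) ∂P := by
  have markov := mul_meas_ge_le_integral_of_nonneg (ae_of_all P fun ω => (X ω).cast_nonneg) hX 1
  rw [one_mul] at markov
  refine (hlb.trans (measureReal_mono fun ω hω => ?_)).trans markov
  simp_all

theorem tendsto_measureReal_lt_atTop (hX : Measurable X) :
    Tendsto (fun k : ℕ => P.real {ω | k < X ω}) atTop (𝓝 0) := by
  have hempty : ⋂ k : ℕ, {ω | k < X ω} = ∅ :=
    Set.eq_empty_of_forall_notMem fun ω hω => lt_irrefl (X ω) (Set.mem_iInter.1 hω (X ω))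
  have h := tendsto_measure_iInter_atTop (μ := P) (s := fun k : ℕ => {ω | k < X ω})
    (fun k => (measurableSet_lt measurable_const hX).nullMeasurableSet)
    (fun k l hkl ω hω => hkl.trans_lt hω) ⟨0, by finiteness⟩
  rw [hempty, measure_empty] at h
  exact (ENNReal.tendsto_toReal ENNReal.zero_ne_top).comp h

theorem measureReal_natCast_lt_le (hX : Measurable X) (hβ : 1 < β)
    (hub : ∀ k : ℕ, 1 ≤ k → P.real {ω | X ω = k} ≤ C * (k : ℝ) ^ (-β)) (k : ℕ) :
    P.real {ω | k < X ω} ≤ tailConst β C * ((k : ℝ) + 1) ^ (1 - β) := by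
  have hC := nonneg_of_measureReal_eq_le hub
  set f : ℕ → ℝ := fun k => P.real {ω | k < X ω} - tailConst β C * ((k : ℝ) + 1) ^ (1 - β)
  have hmono : Monotone f := monotone_nat_of_le_succ fun k => by
    have hsplit : P.real {ω | k < X ω} ≤
        P.real {ω | X ω = (k + 1 : ℕ)} + P.real {ω | k + 1 < X ω} :=
      (measureReal_mono fun ω (hω : k < X ω) => (Nat.eq_or_lt_of_le hω).imp_left Eq.symm).trans
        (measureReal_union_le _ _)
    have hatom := (hub (k + 1) k.succ_pos).trans <| mul_le_mul_of_nonneg_left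
      (rpow_neg_le_mul_rpow_sub hβ (by simp : (1 : ℝ) ≤ (k + 1 : ℕ))) hC
    simp only [f, tailConst, Nat.cast_succ] at hatom ⊢
    linarith
  have hlim : Tendsto f atTop (𝓝 0) := by
    have hpow : Tendsto (fun k : ℕ => ((k : ℝ) + 1) ^ (1 - β)) atTop (𝓝 0) := by
      have := (tendsto_rpow_neg_atTop (sub_pos.2 hβ)).comp
        (tendsto_atTop_add_const_right _ 1 (tendsto_natCast_atTop_atTop (R := ℝ)))
      simpa [Function.comp_def] using this
    simpa using (tendsto_measureReal_lt_atTop hX).sub (hpow.const_mul (tailConst β C))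
  exact sub_nonpos.1 (hmono.ge_of_tendsto hlim k)

theorem measureReal_lt_le (hX : Measurable X) (hβ : 1 < β)
    (hub : ∀ k : ℕ, 1 ≤ k → P.real {ω | X ω = k} ≤ C * (k : ℝ) ^ (-β)) {b : ℝ} (hb : 0 < b) :
    P.real {ω | b < X ω} ≤ tailConst β C * b ^ (1 - β) := by
  have hD : 0 ≤ tailConst β C := tailConst_nonneg hβ (nonneg_of_measureReal_eq_le hub)
  calc P.real {ω | b < X ω} ≤ P.real {ω | ⌊b⌋₊ < X ω} :=
        measureReal_mono fun ω hω => (Nat.floor_lt hb.le).2 hω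
    _ ≤ tailConst β C * ((⌊b⌋₊ : ℝ) + 1) ^ (1 - β) := measureReal_natCast_lt_le hX hβ hub _
    _ ≤ tailConst β C * b ^ (1 - β) := mul_le_mul_of_nonneg_left
        (Real.rpow_le_rpow_of_nonpos hb (Nat.lt_floor_add_one b).le (by linarith)) hD

end PowerLaw

/-- The event that `ξ i` is the only variable with index in `s` exceeding `b`. This is the
one big jump through which a sum of heavy-tailed variables attains an atypically large value. -/
def uniqueBigJump {Ω ι : Type*} [DecidableEq ι] (ξ : ι → Ω → ℕ) (s : Finset ι) (b : ℝ) (i : ι) :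
    Set Ω :=
  {ω | b < ξ i ω ∧ ∀ j ∈ s.erase i, (ξ j ω : ℝ) ≤ b}

theorem pairwiseDisjoint_uniqueBigJump {Ω ι : Type*} [DecidableEq ι] (ξ : ι → Ω → ℕ)
    (s : Finset ι) (b : ℝ) :
    (s : Set ι).PairwiseDisjoint (uniqueBigJump ξ s b) := fun _ _ j hj hij =>
  Set.disjoint_left.2 fun _ hi hj' =>
    (hi.2 j (Finset.mem_erase.2 ⟨hij.symm, hj⟩)).not_gt hj'.1

section Sums

variable {Ω ι : Type*} [MeasurableSpace Ω] {P : Measure Ω} {ξ : ι → Ω → ℕ} {β c C : ℝ}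

theorem indepFun_restrict_of_notMem (hξ_meas : ∀ i, Measurable (ξ i)) (hξ_indep : iIndepFun ξ P)
    {s : Finset ι} {i : ι} (hi : i ∉ s) : IndepFun (fun ω (j : s) => ξ j ω) (ξ i) P :=
  (hξ_indep.indepFun_finset s {i} (Finset.disjoint_singleton_right.2 hi) hξ_meas).comp
    measurable_id (measurable_pi_apply (⟨i, Finset.mem_singleton_self i⟩ : ({i} : Finset ι)))

theorem measurableSet_uniqueBigJump [DecidableEq ι] (hξ_meas : ∀ i, Measurable (ξ i))
    (s : Finset ι) (b : ℝ) (i : ι) : MeasurableSet (uniqueBigJump ξ s b i) := by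
  have hcast : ∀ j, Measurable fun ω => (ξ j ω : ℝ) := fun j => by fun_prop
  have hset : uniqueBigJump ξ s b i =
      {ω | b < ξ i ω} ∩ ⋂ j ∈ s.erase i, {ω | (ξ j ω : ℝ) ≤ b} := by
    ext ω; simp only [uniqueBigJump, Set.mem_inter_iff, Set.mem_iInter, Set.mem_ofPred_eq]
  rw [hset]
  exact (measurableSet_lt measurable_const (hcast i)).inter <|
    Finset.measurableSet_biInter _ fun j _ => measurableSet_le (hcast j) measurable_const

theorem card_mul_le_sum_integral [IsFiniteMeasure P] {s : Finset ι}
    (hint : ∀ i ∈ s, Integrable (fun ω => (ξ i ω : ℝ)) P)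
    (hlb : ∀ i ∈ s, c ≤ P.real {ω | ξ i ω = 1}) :
    s.card * c ≤ ∑ i ∈ s, ∫ ω, (ξ i ω : ℝ) ∂P := by
  rw [← nsmul_eq_mul]
  exact Finset.card_nsmul_le_sum _ _ _ fun i hi =>
    le_integral_natCast_of_le_measureReal_eq_one (hint i hi) (hlb i hi)

variable [IsProbabilityMeasure P]

theorem le_measureReal_sum_lt_and_forall_le (hξ_meas : ∀ i, Measurable (ξ i)) (hβ : 2 < β)
    (hub : ∀ i, ∀ k : ℕ, 1 ≤ k → P.real {ω | ξ i ω = k} ≤ C * (k : ℝ) ^ (-β))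
    (s : Finset ι) {A b : ℝ} (hA : 0 < A) (hb : 0 < b) :
    1 - (∑ i ∈ s, ∫ ω, (ξ i ω : ℝ) ∂P) / A - s.card * (tailConst β C * b ^ (1 - β)) ≤
      P.real {ω | ((∑ i ∈ s, ξ i ω : ℕ) : ℝ) < A ∧ ∀ i ∈ s, (ξ i ω : ℝ) ≤ b} := by
  have hint : ∀ i, Integrable (fun ω => (ξ i ω : ℝ)) P := fun i =>
    integrable_natCast_of_measureReal_eq_le (hξ_meas i) hβ (hub i)
  have markov : P.real {ω | A ≤ ∑ i ∈ s, (ξ i ω : ℝ)} ≤ (∑ i ∈ s, ∫ ω, (ξ i ω : ℝ) ∂P) / A := by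
    rw [le_div_iff₀' hA, ← integral_finsetSum s fun i _ => hint i]
    exact mul_meas_ge_le_integral_of_nonneg (ae_of_all P fun ω => by positivity)
      (integrable_finsetSum s fun i _ => hint i) A
  have union : P.real (⋃ i ∈ s, {ω | b < ξ i ω}) ≤ s.card * (tailConst β C * b ^ (1 - β)) := by
    rw [← nsmul_eq_mul]
    exact (measureReal_biUnion_finset_le _ _).trans <| Finset.sum_le_card_nsmul _ _ _ fun i _ =>
      measureReal_lt_le (hξ_meas i) (by linarith) (hub i) hb
  set G := {ω | ((∑ i ∈ s, ξ i ω : ℕ) : ℝ) < A ∧ ∀ i ∈ s, (ξ i ω : ℝ) ≤ b}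
  have hcover : Set.univ ⊆ G ∪ ({ω | A ≤ ∑ i ∈ s, (ξ i ω : ℝ)} ∪ ⋃ i ∈ s, {ω | b < ξ i ω}) := by
    intro ω _
    simp only [G, Set.mem_union, Set.mem_ofPred_eq, Set.mem_iUnion, exists_prop, Nat.cast_sum]
    grind
  have htotal := (measureReal_mono (μ := P) hcover).trans <| (measureReal_union_le _ _).trans
    (add_le_add_right (measureReal_union_le _ _) _)
  rw [probReal_univ] at htotal
  linarith

theorem exists_forall_le_measureReal_sum_lt_and_forall_le [Nonempty ι]
    (hξ_meas : ∀ i, Measurable (ξ i)) (hβ : 2 < β) (hc : 0 < c)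
    (hlb : ∀ i, ∀ k : ℕ, 1 ≤ k → c * (k : ℝ) ^ (-β) ≤ P.real {ω | ξ i ω = k})
    (hub : ∀ i, ∀ k : ℕ, 1 ≤ k → P.real {ω | ξ i ω = k} ≤ C * (k : ℝ) ^ (-β))
    {q : ℝ} (hq0 : 0 ≤ q) (hq1 : q < 1) :
    ∃ δ > 0, ∀ᶠ m : ℕ in atTop, ∀ s : Finset ι,
      ∑ i ∈ s, ∫ ω, (ξ i ω : ℝ) ∂P ≤ q * m →
      δ / 2 ≤ P.real {ω | ((∑ i ∈ s, ξ i ω : ℕ) : ℝ) < (1 - δ) * m ∧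
        ∀ i ∈ s, (ξ i ω : ℝ) ≤ δ * m} := by
  set δ := (1 - q) / 2 with hδ
  have hδ0 : 0 < δ := by linarith
  have hδ1 : 0 < 1 - δ := by linarith
  refine ⟨δ, hδ0, ?_⟩
  have hlim : Tendsto (fun m : ℕ => q / c * (tailConst β C * δ ^ (1 - β)) * (m : ℝ) ^ (-(β - 2)))
      atTop (𝓝 0) := by
    simpa using ((tendsto_rpow_neg_atTop (sub_pos.2 hβ)).comp
      tendsto_natCast_atTop_atTop).const_mul (q / c * (tailConst β C * δ ^ (1 - β)))
  filter_upwards [hlim.eventually_le_const (half_pos hδ0), eventually_gt_atTop 0]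
    with m hm hm0 s hmean
  have hm0 : (0 : ℝ) < m := by exact_mod_cast hm0
  have hcard : (s.card : ℝ) ≤ q / c * m := by
    have h := card_mul_le_sum_integral (c := c) (s := s)
      (fun i _ => integrable_natCast_of_measureReal_eq_le (hξ_meas i) hβ (hub i))
      fun i _ => by simpa using hlb i 1 le_rfl
    rw [div_mul_eq_mul_div, le_div_iff₀ hc]
    exact h.trans hmean
  have hmarkov : (∑ i ∈ s, ∫ ω, (ξ i ω : ℝ) ∂P) / ((1 - δ) * m) ≤ 1 - δ := by
    rw [div_le_iff₀ (by positivity)]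
    refine hmean.trans ?_
    rw [← mul_assoc]
    gcongr
    nlinarith [sq_nonneg δ]
  have hunion : s.card * (tailConst β C * (δ * m) ^ (1 - β)) ≤ δ / 2 := by
    have htail : 0 ≤ tailConst β C * (δ * m) ^ (1 - β) :=
      mul_nonneg (tailConst_nonneg (by linarith) (nonneg_of_measureReal_eq_le
        (hub (Classical.arbitrary ι)))) (by positivity)
    refine (mul_le_mul_of_nonneg_right hcard htail).trans (le_of_eq_of_le ?_ hm)
    rw [Real.mul_rpow hδ0.le hm0.le, show -(β - 2) = 1 - β + 1 by ring,
      Real.rpow_add_one hm0.ne']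
    ring
  have h := le_measureReal_sum_lt_and_forall_le hξ_meas hβ hub s
    (mul_pos hδ1 hm0) (mul_pos hδ0 hm0)
  linarith

/-- Given the other variables, `ξ i` has to take the value `m - ∑ j ∈ s.erase i, ξ j`, an atom of
mass at least `c * m ^ (-β)`; this value exceeds `δ * m`. -/
theorem le_measureReal_sum_eq_inter_uniqueBigJump [DecidableEq ι] (hξ_meas : ∀ i, Measurable (ξ i))
    (hξ_indep : iIndepFun ξ P) (hβ : 0 ≤ β) (hc : 0 ≤ c)
    (hlb : ∀ i, ∀ k : ℕ, 1 ≤ k → c * (k : ℝ) ^ (-β) ≤ P.real {ω | ξ i ω = k})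
    {s : Finset ι} {i : ι} (hi : i ∈ s) {δ : ℝ} (hδ : 0 ≤ δ) (m : ℕ) :
    c * (m : ℝ) ^ (-β) * P.real {ω | ((∑ j ∈ s.erase i, ξ j ω : ℕ) : ℝ) < (1 - δ) * m ∧
        ∀ j ∈ s.erase i, (ξ j ω : ℝ) ≤ δ * m} ≤
      P.real ({ω | ∑ j ∈ s, ξ j ω = m} ∩ uniqueBigJump ξ s (δ * m) i) := by
  have hlt_of : ∀ {u : ℕ}, (u : ℝ) < (1 - δ) * m → u < m := fun hu => by
    have : 0 ≤ δ * m := by positivity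
    exact_mod_cast (by linarith : ((_ : ℕ) : ℝ) < m)
  have hjoint := le_measureReal_mem_and_mem
    (Y := fun ω (j : s.erase i) => ξ j ω) (by fun_prop) (hξ_meas i)
    (indepFun_restrict_of_notMem hξ_meas hξ_indep (s.notMem_erase i))
    (B := {t | ((∑ j, t j : ℕ) : ℝ) < (1 - δ) * m ∧ ∀ j, (t j : ℝ) ≤ δ * m})
    (g := fun t => {m - ∑ j, t j}) (M := c * (m : ℝ) ^ (-β)) (by positivity) fun t ht => by
      have hlt := hlt_of ht.1
      refine le_trans ?_ (hlb i (m - ∑ j, t j) (by omega))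
      gcongr c * ?_
      exact Real.rpow_le_rpow_of_nonpos (by exact_mod_cast Nat.sub_pos_of_lt hlt)
        (by exact_mod_cast Nat.sub_le _ _) (by linarith)
  have hcoe : ∀ ω, ∑ j : s.erase i, ξ j ω = ∑ j ∈ s.erase i, ξ j ω := fun ω =>
    Finset.sum_coe_sort (s.erase i) fun j => ξ j ω
  simp only [Set.preimage_ofPred_eq, Set.mem_ofPred_eq, Set.mem_singleton_iff, Subtype.forall,
    hcoe] at hjoint
  refine hjoint.trans (measureReal_mono ?_)
  rintro ω ⟨⟨hsum, hsmall⟩, hi_eq⟩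
  have htotal : ξ i ω + ∑ j ∈ s.erase i, ξ j ω = m := by have := hlt_of hsum; omega
  refine ⟨(Finset.add_sum_erase s (fun j => ξ j ω) hi).symm.trans htotal, ?_, hsmall⟩
  have : (ξ i ω : ℝ) + ((∑ j ∈ s.erase i, ξ j ω : ℕ) : ℝ) = m := by exact_mod_cast htotal
  linarith

theorem exists_forall_le_measureReal_sum_eq [Nonempty ι]
    (hξ_meas : ∀ i, Measurable (ξ i)) (hξ_indep : iIndepFun ξ P) (hβ : 2 < β) (hc : 0 < c)
    (hlb : ∀ i, ∀ k : ℕ, 1 ≤ k → c * (k : ℝ) ^ (-β) ≤ P.real {ω | ξ i ω = k})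
    (hub : ∀ i, ∀ k : ℕ, 1 ≤ k → P.real {ω | ξ i ω = k} ≤ C * (k : ℝ) ^ (-β))
    {q : ℝ} (hq0 : 0 ≤ q) (hq1 : q < 1) :
    ∃ κ > 0, ∀ᶠ m : ℕ in atTop, ∀ s : Finset ι, ∑ i ∈ s, ∫ ω, (ξ i ω : ℝ) ∂P ≤ q * m →
      κ * s.card * (m : ℝ) ^ (-β) ≤ P.real {ω | ∑ i ∈ s, ξ i ω = m} := by
  classical
  obtain ⟨δ, hδ, hsmall⟩ :=
    exists_forall_le_measureReal_sum_lt_and_forall_le hξ_meas hβ hc hlb hub hq0 hq1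
  refine ⟨c * (δ / 2), by positivity, ?_⟩
  filter_upwards [hsmall] with m hsmall s hmean
  set J : ι → Set Ω := fun i => {ω | ∑ j ∈ s, ξ j ω = m} ∩ uniqueBigJump ξ s (δ * m) i
  have hJ : ∀ i ∈ s, c * (m : ℝ) ^ (-β) * (δ / 2) ≤ P.real (J i) := fun i hi => by
    have hrest : ∑ j ∈ s.erase i, ∫ ω, (ξ j ω : ℝ) ∂P ≤ q * m :=
      (Finset.sum_le_sum_of_subset_of_nonneg (s.erase_subset i) fun j _ _ =>
        integral_nonneg fun ω => by positivity).trans hmean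
    refine le_trans ?_ (le_measureReal_sum_eq_inter_uniqueBigJump hξ_meas hξ_indep
      (by linarith) hc.le hlb hi hδ.le m)
    gcongr
    exact hsmall _ hrest
  calc c * (δ / 2) * s.card * (m : ℝ) ^ (-β)
      = s.card • (c * (m : ℝ) ^ (-β) * (δ / 2)) := by rw [nsmul_eq_mul]; ring
    _ ≤ ∑ i ∈ s, P.real (J i) := Finset.card_nsmul_le_sum _ _ _ hJ
    _ = P.real (⋃ i ∈ s, J i) := (measureReal_biUnion_finset
        ((pairwiseDisjoint_uniqueBigJump ξ s (δ * m)).mono fun i => Set.inter_subset_right)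
        fun i _ => (measurableSet_eq_fun (by fun_prop) measurable_const).inter
          (measurableSet_uniqueBigJump hξ_meas s _ i)).symm
    _ ≤ P.real {ω | ∑ i ∈ s, ξ i ω = m} :=
        measureReal_mono (Set.iUnion₂_subset fun i _ => Set.inter_subset_left)

/-- Given the other variables, at most one value of `ξ i` is compatible with the sum. -/
theorem measureReal_sum_eq_and_lt_and_lt_le [DecidableEq ι] (hξ_meas : ∀ i, Measurable (ξ i))
    (hξ_indep : iIndepFun ξ P) (hβ : 1 < β)
    (hub : ∀ i, ∀ k : ℕ, 1 ≤ k → P.real {ω | ξ i ω = k} ≤ C * (k : ℝ) ^ (-β))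
    {s : Finset ι} {i j : ι} (hi : i ∈ s) (hj : j ∈ s.erase i) (m : ℕ) {a b : ℝ} (ha : 0 < a)
    (hb : 0 < b) :
    P.real {ω | ∑ l ∈ s, ξ l ω = m ∧ a < ξ i ω ∧ b < ξ j ω} ≤
      C * a ^ (-β) * (tailConst β C * b ^ (1 - β)) := by
  have hC : 0 ≤ C := nonneg_of_measureReal_eq_le (hub i)
  have hatom : ∀ u : ℕ, P.real {ω | a < ξ i ω ∧ ξ i ω + u = m} ≤ C * a ^ (-β) := fun u => by
    by_cases hk : a < (m - u : ℕ)
    · calc P.real {ω | a < ξ i ω ∧ ξ i ω + u = m} ≤ P.real {ω | ξ i ω = m - u} :=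
            measureReal_mono fun ω hω => Nat.eq_sub_of_add_eq hω.2
        _ ≤ C * (m - u : ℕ) ^ (-β) := hub i _ (by exact_mod_cast ha.trans hk)
        _ ≤ C * a ^ (-β) := by
            gcongr C * ?_
            exact Real.rpow_le_rpow_of_nonpos ha hk.le (by linarith)
    · have hempty : {ω | a < ξ i ω ∧ ξ i ω + u = m} = ∅ :=
        Set.eq_empty_of_forall_notMem fun ω hω => hk (Nat.eq_sub_of_add_eq hω.2 ▸ hω.1)
      rw [hempty, measureReal_empty]
      positivity
  have hjoint := measureReal_mem_and_mem_le
    (Y := fun ω (l : s.erase i) => ξ l ω) (by fun_prop) (hξ_meas i)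
    (indepFun_restrict_of_notMem hξ_meas hξ_indep (s.notMem_erase i))
    (B := {t | b < t ⟨j, hj⟩}) (g := fun t => {k | a < k ∧ k + ∑ l, t l = m})
    (by positivity) fun t _ => hatom (∑ l, t l)
  have hcoe : ∀ ω, ∑ l : s.erase i, ξ l ω = ∑ l ∈ s.erase i, ξ l ω := fun ω =>
    Finset.sum_coe_sort (s.erase i) fun l => ξ l ω
  simp only [Set.preimage_ofPred_eq, Set.mem_ofPred_eq, hcoe] at hjoint
  have hsub : {ω | ∑ l ∈ s, ξ l ω = m ∧ a < ξ i ω ∧ b < ξ j ω} ⊆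
      {ω | b < ξ j ω ∧ a < ξ i ω ∧ ξ i ω + ∑ l ∈ s.erase i, ξ l ω = m} :=
    fun ω hω => ⟨hω.2.2, hω.2.1, (Finset.add_sum_erase s (fun l => ξ l ω) hi).trans hω.1⟩
  calc P.real {ω | ∑ l ∈ s, ξ l ω = m ∧ a < ξ i ω ∧ b < ξ j ω}
      ≤ C * a ^ (-β) * P.real {ω | b < ξ j ω} :=
        (measureReal_mono hsub).trans hjoint
    _ ≤ C * a ^ (-β) * (tailConst β C * b ^ (1 - β)) := by
        gcongr
        exact measureReal_lt_le (hξ_meas j) hβ (hub j) hb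

theorem measureReal_sum_eq_and_exists_lt_lt_le [Nonempty ι] (hξ_meas : ∀ i, Measurable (ξ i))
    (hξ_indep : iIndepFun ξ P) (hβ : 1 < β)
    (hub : ∀ i, ∀ k : ℕ, 1 ≤ k → P.real {ω | ξ i ω = k} ≤ C * (k : ℝ) ^ (-β))
    (s : Finset ι) (m : ℕ) {a b : ℝ} (ha : 0 < a) (hb : 0 < b) :
    P.real {ω | ∑ l ∈ s, ξ l ω = m ∧ ∃ i ∈ s, ∃ j ∈ s, i ≠ j ∧ a < ξ i ω ∧ b < ξ j ω} ≤
      s.card ^ 2 * (C * a ^ (-β) * (tailConst β C * b ^ (1 - β))) := by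
  classical
  set E : ι × ι → Set Ω := fun p => {ω | ∑ l ∈ s, ξ l ω = m ∧ a < ξ p.1 ω ∧ b < ξ p.2 ω}
  set D := C * a ^ (-β) * (tailConst β C * b ^ (1 - β))
  have hC : 0 ≤ C := nonneg_of_measureReal_eq_le (hub (Classical.arbitrary ι))
  have hD : 0 ≤ D :=
    mul_nonneg (by positivity) (mul_nonneg (tailConst_nonneg hβ hC) (by positivity))
  have hsub : {ω | ∑ l ∈ s, ξ l ω = m ∧ ∃ i ∈ s, ∃ j ∈ s, i ≠ j ∧ a < ξ i ω ∧ b < ξ j ω} ⊆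
      ⋃ p ∈ s.offDiag, E p := by
    rintro ω ⟨hsum, i, hi, j, hj, hij, hai, hbj⟩
    exact Set.mem_biUnion (Finset.mem_offDiag.2 ⟨hi, hj, hij⟩ : (i, j) ∈ _) ⟨hsum, hai, hbj⟩
  have hE : ∀ p ∈ s.offDiag, P.real (E p) ≤ D := fun p hp => by
    obtain ⟨hi, hj, hij⟩ := Finset.mem_offDiag.1 hp
    exact measureReal_sum_eq_and_lt_and_lt_le hξ_meas hξ_indep hβ hub hi
      (Finset.mem_erase.2 ⟨hij.symm, hj⟩) m ha hb
  have hcard : s.offDiag.card ≤ s.card ^ 2 := by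
    rw [Finset.offDiag_card, sq]
    exact Nat.sub_le _ _
  calc _ ≤ ∑ p ∈ s.offDiag, P.real (E p) :=
        (measureReal_mono hsub (measure_ne_top _ _)).trans (measureReal_biUnion_finset_le _ _)
    _ ≤ s.offDiag.card • D := Finset.sum_le_card_nsmul _ _ _ hE
    _ ≤ s.card ^ 2 * D := by rw [nsmul_eq_mul]; gcongr; exact_mod_cast hcard

end Sums

section Asymptotics

variable {α : Type*} {l : Filter α}

theorem exists_nonneg_lt_one_eventually_le_of_limsup_lt_one {f : α → ℝ}
    (h : limsup (fun x => (f x : EReal)) l < 1) :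
    ∃ q : ℝ, 0 ≤ q ∧ q < 1 ∧ ∀ᶠ x in l, f x ≤ q := by
  obtain ⟨q, hq, hq1⟩ := EReal.lt_iff_exists_real_btwn.1 h
  refine ⟨max q 0, le_max_right _ _, max_lt (by exact_mod_cast hq1) one_pos, ?_⟩
  filter_upwards [eventually_lt_of_limsup_lt hq] with x hx
  exact (EReal.coe_lt_coe_iff.1 hx).le.trans (le_max_left _ _)

theorem measureReal_cond_eq_div {Ω : Type*} [MeasurableSpace Ω] {P : Measure Ω} {E : Set Ω}
    (hE : MeasurableSet E) (F : Set Ω) : P[|E].real F = P.real (E ∩ F) / P.real E := by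
  rw [measureReal_def, cond_apply hE, ENNReal.toReal_mul, ENNReal.toReal_inv, ← measureReal_def,
    ← measureReal_def, inv_mul_eq_div]

theorem exists_ne_of_lt_kthLargest {x : ℕ → ℕ} {N : ℕ} {a b : ℝ} (hb : 0 ≤ b)
    (h₁ : a < kthLargest x N 1) (h₂ : b < kthLargest x N 2) :
    ∃ i ∈ Finset.range N, ∃ j ∈ Finset.range N, i ≠ j ∧ a < x i ∧ b < x j := by
  have hsort := Multiset.sort_eq ((Multiset.range N).map x) (· ≥ ·)
  unfold kthLargest at h₁ h₂
  match hl : ((Multiset.range N).map x).sort (· ≥ ·) with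
  | [] | [_] => simp [hl] at h₂; linarith
  | u :: v :: t =>
    simp only [hl, List.getD_cons_zero, List.getD_cons_succ, Nat.sub_self,
      Nat.add_one_sub_one] at h₁ h₂
    rw [hl, ← Multiset.cons_coe, ← Multiset.cons_coe] at hsort
    obtain ⟨i, hi, rfl, hrest⟩ := (Multiset.map_eq_cons x _ _ _).2 hsort.symm
    obtain ⟨j, hj, rfl, -⟩ := (Multiset.map_eq_cons x _ _ _).2 hrest
    obtain ⟨hji, hj⟩ := (Multiset.nodup_range N).mem_erase_iff.1 hj
    exact ⟨i, Finset.mem_range.2 (Multiset.mem_range.1 hi), j,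
      Finset.mem_range.2 (Multiset.mem_range.1 hj), hji.symm, h₁, h₂⟩

variable {Ω : Type*} [MeasurableSpace Ω] {P : Measure Ω} [IsProbabilityMeasure P]
  {ξ : ℕ → Ω → ℕ} {β c C : ℝ} {m N : α → ℕ}

theorem measureReal_sum_eq_inter_lt_kthLargest_le (hξ_meas : ∀ i, Measurable (ξ i))
    (hξ_indep : iIndepFun ξ P) (hβ : 1 < β)
    (hub : ∀ i, ∀ k : ℕ, 1 ≤ k → P.real {ω | ξ i ω = k} ≤ C * (k : ℝ) ^ (-β))
    (N m : ℕ) {a b : ℝ} (ha : 0 < a) (hb : 0 < b) :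
    P.real ({ω | ∑ i ∈ Finset.range N, ξ i ω = m} ∩
        {ω | a < kthLargest (fun i => ξ i ω) N 1 ∧ b < kthLargest (fun i => ξ i ω) N 2}) ≤
      N ^ 2 * (C * a ^ (-β) * (tailConst β C * b ^ (1 - β))) := by
  have h := measureReal_sum_eq_and_exists_lt_lt_le hξ_meas hξ_indep hβ hub (.range N) m ha hb
  rw [Finset.card_range] at h
  refine (measureReal_mono ?_).trans h
  rintro ω ⟨hsum, h₁, h₂⟩
  exact ⟨hsum, exists_ne_of_lt_kthLargest hb.le h₁ h₂⟩

theorem exists_eventually_le_measureReal_sum_range_eq (hξ_meas : ∀ i, Measurable (ξ i))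
    (hξ_indep : iIndepFun ξ P) (hβ : 2 < β) (hc : 0 < c)
    (hlb : ∀ i, ∀ k : ℕ, 1 ≤ k → c * (k : ℝ) ^ (-β) ≤ P.real {ω | ξ i ω = k})
    (hub : ∀ i, ∀ k : ℕ, 1 ≤ k → P.real {ω | ξ i ω = k} ≤ C * (k : ℝ) ^ (-β))
    (hm : Tendsto m l atTop)
    (hlimsup : limsup (fun x =>
      (((∑ i ∈ Finset.range (N x), ∫ ω, (ξ i ω : ℝ) ∂P) / m x : ℝ) : EReal)) l < 1) :
    ∃ κ > 0, ∀ᶠ x in l,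
      κ * N x * (m x : ℝ) ^ (-β) ≤ P.real {ω | ∑ i ∈ Finset.range (N x), ξ i ω = m x} := by
  obtain ⟨q, hq0, hq1, hq⟩ := exists_nonneg_lt_one_eventually_le_of_limsup_lt_one hlimsup
  obtain ⟨κ, hκ, hsum⟩ :=
    exists_forall_le_measureReal_sum_eq hξ_meas hξ_indep hβ hc hlb hub hq0 hq1
  refine ⟨κ, hκ, ?_⟩
  filter_upwards [hq, hm.eventually hsum, hm.eventually (eventually_gt_atTop 0)]
    with x hqx hsumx hmx
  have hmx : (0 : ℝ) < m x := by exact_mod_cast hmx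
  simpa using hsumx (.range (N x)) ((div_le_iff₀ hmx).1 hqx)

theorem measureReal_cond_lt_kthLargest_le (hξ_meas : ∀ i, Measurable (ξ i))
    (hξ_indep : iIndepFun ξ P) (hβ : 1 < β)
    (hub : ∀ i, ∀ k : ℕ, 1 ≤ k → P.real {ω | ξ i ω = k} ≤ C * (k : ℝ) ^ (-β))
    {N m : ℕ} {κ L b : ℝ} (hκ : 0 < κ) (hN : 0 < N) (hm : 0 < m)
    (hsum : κ * N * (m : ℝ) ^ (-β) ≤ P.real {ω | ∑ i ∈ Finset.range N, ξ i ω = m})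
    (hL : 0 < L) (hb : 0 < b) :
    P[|{ω | ∑ i ∈ Finset.range N, ξ i ω = m}].real
        {ω | (m : ℝ) / L < kthLargest (fun i => ξ i ω) N 1 ∧
          b < kthLargest (fun i => ξ i ω) N 2} ≤
      C * tailConst β C / κ * (N * (L ^ β * b ^ (1 - β))) := by
  have hC : 0 ≤ C := nonneg_of_measureReal_eq_le (hub 0)
  have hD : 0 ≤ tailConst β C := tailConst_nonneg hβ hC
  have hm' : (0 : ℝ) < m := by exact_mod_cast hm
  have hlower : 0 < κ * N * (m : ℝ) ^ (-β) := by positivity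
  rw [measureReal_cond_eq_div (measurableSet_eq_fun (by fun_prop) measurable_const),
    div_le_iff₀ (hlower.trans_le hsum)]
  calc _ ≤ _ := measureReal_sum_eq_inter_lt_kthLargest_le hξ_meas hξ_indep hβ hub N m
        (div_pos hm' hL) hb
    _ = C * tailConst β C / κ * (N * (L ^ β * b ^ (1 - β))) * (κ * N * (m : ℝ) ^ (-β)) := by
        rw [Real.div_rpow hm'.le hL.le, Real.rpow_neg hL.le]
        field_simp
    _ ≤ _ := by gcongr

end Asymptotics

section PowerWeights

theorem exists_pos_le_and_le_of_tendsto {f : ℕ → ℝ} {a : ℝ} (hf : ∀ k : ℕ, 1 ≤ k → 0 < f k)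
    (ha : 0 < a) (hlim : Tendsto f atTop (𝓝 a)) :
    ∃ c C : ℝ, 0 < c ∧ ∀ k : ℕ, 1 ≤ k → c ≤ f k ∧ f k ≤ C := by
  obtain ⟨C, hC⟩ := hlim.bddAbove_range
  obtain ⟨C', hC'⟩ := (hlim.inv₀ ha.ne').bddAbove_range
  refine ⟨(max C' 1)⁻¹, C, by positivity, fun k hk => ⟨?_, hC ⟨k, rfl⟩⟩⟩
  rw [inv_le_comm₀ (by positivity) (hf k hk)]
  exact (hC' ⟨k, rfl⟩).trans (le_max_left _ _)

variable {ψ : ℕ → ℝ}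

theorem weight_eq_mul_rpow (ψ : ℕ → ℝ) (k : ℕ) :
    weight ψ k = (1 + ψ k) * (k : ℝ) ^ (-(5 / 2 : ℝ)) := by
  rw [weight, Real.rpow_neg (by positivity), div_eq_mul_inv]

theorem exists_weight_bounds (hψ_gt : ∀ k : ℕ, 1 ≤ k → -1 < ψ k)
    (hψ_lim : Tendsto ψ atTop (𝓝 0)) :
    ∃ c C : ℝ, 0 < c ∧ ∀ k : ℕ, 1 ≤ k →
      c * (k : ℝ) ^ (-(5 / 2 : ℝ)) ≤ weight ψ k ∧ weight ψ k ≤ C * (k : ℝ) ^ (-(5 / 2 : ℝ)) := by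
  obtain ⟨c, C, hc, hψ⟩ := exists_pos_le_and_le_of_tendsto (f := fun k => 1 + ψ k)
    (fun k hk => by linarith [hψ_gt k hk]) one_pos (by simpa using hψ_lim.const_add 1)
  refine ⟨c, C, hc, fun k hk => ?_⟩
  rw [weight_eq_mul_rpow]
  exact ⟨mul_le_mul_of_nonneg_right (hψ k hk).1 (by positivity),
    mul_le_mul_of_nonneg_right (hψ k hk).2 (by positivity)⟩

theorem totalWeight_pos (hψ_gt : ∀ k : ℕ, 1 ≤ k → -1 < ψ k) (hψ_lim : Tendsto ψ atTop (𝓝 0)) :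
    0 < totalWeight ψ := by
  obtain ⟨c, C, hc, hw⟩ := exists_weight_bounds hψ_gt hψ_lim
  have hpos : ∀ l : ℕ, 0 < weight ψ (l + 1) := fun l =>
    (by positivity : 0 < c * ((l + 1 : ℕ) : ℝ) ^ (-(5 / 2 : ℝ))).trans_le (hw _ l.succ_pos).1
  have hsum : Summable fun l : ℕ => C * ((l + 1 : ℕ) : ℝ) ^ (-(5 / 2 : ℝ)) :=
    ((summable_nat_add_iff 1).2 (Real.summable_nat_rpow.2 (by norm_num))).mul_left C
  exact (hsum.of_nonneg_of_le (fun l => (hpos l).le) fun l => (hw _ l.succ_pos).2).tsum_pos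
    (fun l => (hpos l).le) 0 (hpos 0)

theorem exists_measureReal_eq_bounds {Ω ι : Type*} [MeasurableSpace Ω] {P : Measure Ω}
    {ξ : ι → Ω → ℕ} (hψ_gt : ∀ k : ℕ, 1 ≤ k → -1 < ψ k) (hψ_lim : Tendsto ψ atTop (𝓝 0))
    (hξ_law : ∀ i, ∀ k : ℕ, 1 ≤ k → P {ω | ξ i ω = k} = ENNReal.ofReal (prob ψ k)) :
    ∃ c C : ℝ, 0 < c ∧
      (∀ i, ∀ k : ℕ, 1 ≤ k → c * (k : ℝ) ^ (-(5 / 2 : ℝ)) ≤ P.real {ω | ξ i ω = k}) ∧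
      (∀ i, ∀ k : ℕ, 1 ≤ k → P.real {ω | ξ i ω = k} ≤ C * (k : ℝ) ^ (-(5 / 2 : ℝ))) := by
  obtain ⟨c, C, hc, hw⟩ := exists_weight_bounds hψ_gt hψ_lim
  have hW := totalWeight_pos hψ_gt hψ_lim
  have hlaw : ∀ i, ∀ k : ℕ, 1 ≤ k → P.real {ω | ξ i ω = k} = weight ψ k / totalWeight ψ :=
    fun i k hk => by
      have hwk : 0 ≤ weight ψ k := le_trans (by positivity) (hw k hk).1
      rw [measureReal_def, hξ_law i k hk, prob, ENNReal.toReal_ofReal (by positivity)]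
  refine ⟨c / totalWeight ψ, C / totalWeight ψ, by positivity, fun i k hk => ?_, fun i k hk => ?_⟩
  all_goals rw [hlaw i k hk, div_mul_eq_mul_div, div_le_div_iff_of_pos_right hW]
  exacts [(hw k hk).1, (hw k hk).2]

end PowerWeights

theorem sum_range_integral_natCast_eq {Ω : Type*} [MeasurableSpace Ω] {P : Measure Ω}
    {ξ : ℕ → Ω → ℕ} (hξ_meas : ∀ i, Measurable (ξ i))
    (h : ∀ i k : ℕ, 1 ≤ k → P {ω | ξ i ω = k} = P {ω | ξ 0 ω = k}) (N : ℕ) :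
    ∑ i ∈ Finset.range N, ∫ ω, (ξ i ω : ℝ) ∂P = (∫ ω, (ξ 0 ω : ℝ) ∂P) * N := by
  rw [Finset.sum_congr rfl fun i _ => integral_natCast_congr (hξ_meas i) (hξ_meas 0) (h i)]
  simp [mul_comm]

theorem tendsto_natSub_atTop_of_isLittleO {r : ℕ → ℕ}
    (hr : (fun n : ℕ => (r n : ℝ)) =o[atTop] (fun n : ℕ => (n : ℝ))) :
    Tendsto (fun n => n - r n) atTop atTop := by
  refine tendsto_natCast_atTop_iff.1 (tendsto_atTop_mono' atTop ?_
    (tendsto_natCast_atTop_atTop (R := ℝ) |>.atTop_div_const two_pos))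
  filter_upwards [hr.bound (half_pos one_pos)] with n hn
  have hsub : (n : ℝ) - r n ≤ (n - r n : ℕ) := by
    rw [sub_le_iff_le_add]; exact_mod_cast le_tsub_add
  simp only [Real.norm_natCast] at hn
  linarith

theorem log_sq_rpow_mul_rpow_rpow_eq (n r : ℕ) :
    (Real.log n ^ 2) ^ (5 / 2 : ℝ) * ((r : ℝ) ^ ((5 : ℝ) / 6)) ^ (1 - 5 / 2 : ℝ) =
      Real.log n ^ 5 * (r : ℝ) ^ (-(5 : ℝ) / 4) := by
  rw [← Real.rpow_natCast_mul (Real.log_natCast_nonneg n), ← Real.rpow_mul r.cast_nonneg,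
    ← Real.rpow_natCast]
  norm_num

end RandomAllocation

theorem proposition3p2_general {Ω : Type*} [MeasurableSpace Ω] (P : Measure Ω)
    [IsProbabilityMeasure P] (ξ : ℕ → Ω → ℕ) (hξ_meas : ∀ i, Measurable (ξ i))
    (hξ_indep : iIndepFun ξ P) {β c C : ℝ} (hβ : 2 < β) (hc : 0 < c)
    (hlb : ∀ i, ∀ k : ℕ, 1 ≤ k → c * (k : ℝ) ^ (-β) ≤ P.real {ω | ξ i ω = k})
    (hub : ∀ i, ∀ k : ℕ, 1 ≤ k → P.real {ω | ξ i ω = k} ≤ C * (k : ℝ) ^ (-β))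
    {α : Type*} {l : Filter α} (m N : α → ℕ) (L b : α → ℝ) (hm : Tendsto m l atTop)
    (hN : ∀ᶠ x in l, 1 ≤ N x) (hL : ∀ᶠ x in l, 0 < L x) (hb : ∀ᶠ x in l, 0 < b x)
    (hlimsup : limsup (fun x =>
      (((∑ i ∈ Finset.range (N x), ∫ ω, (ξ i ω : ℝ) ∂P) / m x : ℝ) : EReal)) l < 1) :
    (∀ᶠ x in l, 0 < P {ω | ∑ i ∈ Finset.range (N x), ξ i ω = m x}) ∧
    (fun x => (P[|{ω | ∑ i ∈ Finset.range (N x), ξ i ω = m x}]).real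
      {ω | (m x : ℝ) / L x < (RandomAllocation.kthLargest (fun i => ξ i ω) (N x) 1 : ℝ) ∧
        b x < (RandomAllocation.kthLargest (fun i => ξ i ω) (N x) 2 : ℝ)})
      =O[l] fun x => (N x : ℝ) * (L x ^ β * b x ^ (1 - β)) := by
  obtain ⟨κ, hκ, hsum⟩ := RandomAllocation.exists_eventually_le_measureReal_sum_range_eq
    hξ_meas hξ_indep hβ hc hlb hub hm hlimsup
  have hm0 := hm.eventually (eventually_gt_atTop 0)
  refine ⟨?_, .of_bound (C * RandomAllocation.tailConst β C / κ) ?_⟩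
  · filter_upwards [hsum, hm0, hN] with x hx hmx hNx
    have hpos : 0 < κ * N x * (m x : ℝ) ^ (-β) := by positivity
    exact (ENNReal.toReal_pos_iff.1 (hpos.trans_le hx)).1
  · filter_upwards [hsum, hm0, hN, hL, hb] with x hx hmx hNx hLx hbx
    rw [Real.norm_of_nonneg measureReal_nonneg, Real.norm_of_nonneg (by positivity)]
    exact RandomAllocation.measureReal_cond_lt_kthLargest_le hξ_meas hξ_indep (by linarith) hub
      hκ hNx hmx hx hLx hbx

theorem proposition3p2
    -- the law of `ξ`
    (ψ : ℕ → ℝ) (hψ_gt : ∀ k : ℕ, 1 ≤ k → -1 < ψ k) (hψ_lim : Tendsto ψ atTop (𝓝 0))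
    -- independent copies of `ξ` (the `N` first ones are `ξ 0, …, ξ (N - 1)`)
    {Ω : Type*} [MeasurableSpace Ω] (P : Measure Ω) [IsProbabilityMeasure P]
    (ξ : ℕ → Ω → ℕ) (hξ_meas : ∀ i, Measurable (ξ i)) (hξ_indep : iIndepFun ξ P)
    (hξ_law : ∀ i k : ℕ, 1 ≤ k → P {ω | ξ i ω = k} = ENNReal.ofReal (RandomAllocation.prob ψ k))
    -- the sequences `r` and `N`; `m n` is `n - r n`
    (r N : ℕ → ℕ)
    (hr_gt : ∀ᶠ n : ℕ in atTop, Real.log n ^ 25 < (r n : ℝ))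
    (hr_o : (fun n : ℕ => (r n : ℝ)) =o[atTop] (fun n : ℕ => (n : ℝ)))
    (hN : ∀ᶠ n : ℕ in atTop, 1 ≤ N n ∧ N n ≤ n - r n)
    (hlimsup : limsup (fun n : ℕ =>
        (((∫ ω, (ξ 0 ω : ℝ) ∂P) * (N n : ℝ) / ((n - r n : ℕ) : ℝ) : ℝ) : EReal)) atTop < 1) :
    (∀ᶠ n : ℕ in atTop, 0 < P {ω | ∑ i ∈ Finset.range (N n), ξ i ω = n - r n}) ∧
    (fun n : ℕ =>
      (P[|{ω | ∑ i ∈ Finset.range (N n), ξ i ω = n - r n}]).real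
        {ω | ((n - r n : ℕ) : ℝ) / Real.log n ^ 2
                < (RandomAllocation.kthLargest (fun i => ξ i ω) (N n) 1 : ℝ) ∧
             (r n : ℝ) ^ ((5 : ℝ) / 6)
                < (RandomAllocation.kthLargest (fun i => ξ i ω) (N n) 2 : ℝ)})
      =O[atTop] (fun n : ℕ => (N n : ℝ) * Real.log n ^ 5 * (r n : ℝ) ^ (-(5 : ℝ) / 4)) := by
  obtain ⟨c, C, hc, hlb, hub⟩ :=
    RandomAllocation.exists_measureReal_eq_bounds hψ_gt hψ_lim hξ_law
  have hmean := RandomAllocation.sum_range_integral_natCast_eq (P := P) hξ_meas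
    fun i k hk => (hξ_law i k hk).trans (hξ_law 0 k hk).symm
  have hlog : ∀ᶠ n : ℕ in atTop, 0 < Real.log n ^ 2 :=
    ((Real.tendsto_log_atTop.comp tendsto_natCast_atTop_atTop).eventually_gt_atTop 0).mono
      fun _ h => pow_pos h 2
  have hr_pos : ∀ᶠ n in atTop, 0 < (r n : ℝ) ^ ((5 : ℝ) / 6) := hr_gt.mono fun n hn =>
    Real.rpow_pos_of_pos ((pow_nonneg (Real.log_natCast_nonneg n) 25).trans_lt hn) _
  simpa only [RandomAllocation.log_sq_rpow_mul_rpow_rpow_eq, mul_assoc] using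
    proposition3p2_general P ξ hξ_meas hξ_indep (by norm_num) hc hlb hub (fun n => n - r n) N
      (fun n => Real.log n ^ 2) (fun n => (r n : ℝ) ^ ((5 : ℝ) / 6))
      (RandomAllocation.tendsto_natSub_atTop_of_isLittleO hr_o) (hN.mono fun _ h => h.1)
      hlog hr_pos (by simpa only [hmean] using hlimsup)
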